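/- Let $\mathcal A$ be a unital $C^*$-algebra. A projection is a self-adjoint idempotent of $\mathcal A$. An algebra of finite type elements in $\mathcal A$ is a subalgebra $\mathcal F\subseteq\mathcal A$ (not necessarily closed) such that: (i) $\mathcal F$ is a self-adjoint two-sided ideal of $\mathcal A$; (ii) $\mathcal F$ has an approximate unit consisting of projections; (iii) for all projections $p,q\in\mathcal F$ there is $v\in\mathcal A$ with $vv^*=q$ and $v^*v\perp p$. For projections $p,q\in\mathcal F$ write $p\sim q$ if $vv^*=p$ and $v^*v=q$ for some $v\in\mathcal A$. Let $S(\mathcal F)$ be the set of classes of projections of $\mathcal F$ modulo $\sim$, which is a commutative monoid under $[p]+[q]=[p+q']$, where $q'\in\mathcal F$ is any projection with $q'\sim q$ and $q'\perp p$; let $K(\mathcal F)$ be the Grothendieck group of $S(\mathcal F)$. Let $p,q\in\mathcal F$ be projections. An element $a\in\mathcal A$ is invertible up to $(p,q)$ if there is $b\in\mathcal A$ with $b=(1-p)b(1-q)$, $(1-q)a(1-p)\,b=1-q$ and $b\,(1-q)a(1-p)=1-p$. The element $a$ is of Fredholm type if it is invertible up to $(p,q)$ for some projections $p,q\in\mathcal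 F$; its index is then $\operatorname{ind}a=[p]-[q]\in K(\mathcal F)$. Theorem (index theorem). Let $\mathcal F$ be an algebra of finite type elements in $\mathcal A$. The index of a Fredholm type element is well defined, that is, it does not depend on the choice of $(p,q)$. If $t_1$ and $t_2$ are of Fredholm type, then so is $t_1t_2$, and $$\operatorname{ind}(t_1t_2)=\operatorname{ind}t_1+\operatorname{ind}t_2\quad\text{in }K(\mathcal F).$$ In other words, the set $\mathrm{Fred}(\mathcal F)$ of Fredholm type elements is a monoid under multiplication, and $\operatorname{ind}$ is a monoid homomorphism from $(\mathrm{Fred}(\mathcal F),\cdot)$ to $(K(\mathcal F),+)$. -/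

import Mathlib

/-- A (not necessarily closed) algebra of finite type elements in a unital C*-algebra `A`: a
self-adjoint two-sided ideal `F` of `A` which has an approximate unit consisting of projections and
such that for all projections `p, q ∈ F` there is `v ∈ A` with `v v* = q` and `v* v ⟂ p`. -/
structure FiniteTypeElements (A : Type*) [CStarAlgebra A] extends NonUnitalStarSubalgebra ℂ A where
  mul_mem_left' : ∀ (a : A) {b : A}, b ∈ carrier → a * b ∈ carrier
  mul_mem_right' : ∀ (a : A) {b : A}, b ∈ carrier → b * a ∈ carrier
  /-- The approximate unit is given as a filter on `F` (for a net, its filter of tails); it need not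
  be increasing. -/
  exists_approximateUnit' : ∃ l : Filter toNonUnitalStarSubalgebra,
    l.IsApproximateUnit ∧ ∀ᶠ e : toNonUnitalStarSubalgebra in l, IsStarProjection (e : A)
  exists_orthogonal' : ∀ p ∈ carrier, ∀ q ∈ carrier, IsStarProjection p → IsStarProjection q →
    ∃ v : A, v * star v = q ∧ (star v * v) * p = 0

namespace FiniteTypeElements

/-- Murray - von Neumann equivalence `p ∼ q` in `A`. -/
def MvN {A : Type*} [CStarAlgebra A] (p q : A) : Prop :=
  ∃ v : A, v * star v = p ∧ star v * v = q

section MvNFacts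

variable {A : Type*} [CStarAlgebra A]

theorem mul_eq_self_of_projection {v p : A} (hp : IsStarProjection p) (h : v * star v = p) :
    p * v = v := by
  have hpp : p * p = p := hp.isIdempotentElem
  have hps : star p = p := hp.isSelfAdjoint
  have h0 : (p * v - v) * star (p * v - v) = 0 := by
    rw [star_sub, star_mul, hps]
    have h1 : (p * v - v) * (star v * p - star v)
        = p * (v * star v) * p - p * (v * star v) - (v * star v) * p + v * star v := by
      noncomm_ring
    rw [h1, h, hpp, hpp]
    abel
  exact sub_eq_zero.mp ((CStarRing.mul_star_self_eq_zero_iff _).mp h0)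

theorem MvN.refl {p : A} (hp : IsStarProjection p) : MvN p p := by
  have hpp : p * p = p := hp.isIdempotentElem
  have hps : star p = p := hp.isSelfAdjoint
  exact ⟨p, by rw [hps, hpp], by rw [hps, hpp]⟩

theorem MvN.symm {p q : A} (h : MvN p q) : MvN q p := by
  obtain ⟨v, h1, h2⟩ := h
  exact ⟨star v, by rw [star_star, h2], by rw [star_star, h1]⟩

/-- If `v v*` is a projection, then so is `v* v`. -/
theorem isStarProjection_star_mul_self {v : A} (h : IsStarProjection (v * star v)) :
    IsStarProjection (star v * v) := by
  have h1 : v * star v * v = v := mul_eq_self_of_projection h rfl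
  refine ⟨?_, ?_⟩
  · change star v * v * (star v * v) = star v * v
    rw [mul_assoc, ← mul_assoc v, h1]
  · exact IsSelfAdjoint.star_mul_self v

theorem MvN.trans {p q r : A} (hp : IsStarProjection p) (hr : IsStarProjection r)
    (h : MvN p q) (h' : MvN q r) : MvN p r := by
  obtain ⟨v, h1, h2⟩ := h
  obtain ⟨w, h3, h4⟩ := h'
  have e1 : p * v = v := mul_eq_self_of_projection hp h1
  have e2 : r * star w = star w :=
    mul_eq_self_of_projection (v := star w) hr (by rw [star_star, h4])
  refine ⟨v * w, ?_, ?_⟩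
  · calc v * w * star (v * w) = v * (w * star w) * star v := by rw [star_mul]; noncomm_ring
      _ = (v * star v) * v * star v := by rw [h3, ← h2]; noncomm_ring
      _ = p := by rw [h1, e1, h1]
  · calc star (v * w) * (v * w) = star w * (star v * v) * w := by rw [star_mul]; noncomm_ring
      _ = (star w * w) * star w * w := by rw [h2, ← h3]; noncomm_ring
      _ = r := by rw [h4, e2, h4]

theorem mul_eq_zero_swap {p q : A} (hp : IsStarProjection p) (hq : IsStarProjection q)
    (h : p * q = 0) : q * p = 0 := by
  have hps : star p = p := hp.isSelfAdjoint
  have hqs : star q = q := hq.isSelfAdjoint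
  have := congrArg star h
  rwa [star_mul, hps, hqs, star_zero] at this

theorem MvN.add {p q p' q' : A} (hp : IsStarProjection p) (hq : IsStarProjection q)
    (hp' : IsStarProjection p') (hq' : IsStarProjection q') (hpq : p * q = 0)
    (hpq' : p' * q' = 0) (h₁ : MvN p p') (h₂ : MvN q q') : MvN (p + q) (p' + q') := by
  obtain ⟨v, h1, h2⟩ := h₁
  obtain ⟨w, h3, h4⟩ := h₂
  have hps : star p = p := hp.isSelfAdjoint
  have hps' : star p' = p' := hp'.isSelfAdjoint
  have v1 : p * v = v := mul_eq_self_of_projection hp h1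
  have w1 : q * w = w := mul_eq_self_of_projection hq h3
  have v2 : p' * star v = star v :=
    mul_eq_self_of_projection (v := star v) hp' (by rw [star_star, h2])
  have w2 : q' * star w = star w :=
    mul_eq_self_of_projection (v := star w) hq' (by rw [star_star, h4])
  have v3 : v * p' = v := by
    have := congrArg star v2
    rwa [star_mul, star_star, hps'] at this
  have v4 : star v * p = star v := by
    have := congrArg star v1
    rwa [star_mul, hps] at this
  have c1 : v * star w = 0 := by
    rw [← v3, ← w2, mul_assoc, ← mul_assoc p', hpq', zero_mul, mul_zero]
  have c2 : w * star v = 0 := by simpa using congrArg star c1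
  have c3 : star v * w = 0 := by
    rw [← v4, ← w1, mul_assoc, ← mul_assoc p, hpq, zero_mul, mul_zero]
  have c4 : star w * v = 0 := by simpa using congrArg star c3
  refine ⟨v + w, ?_, ?_⟩
  · rw [star_add, add_mul, mul_add, mul_add, c1, c2, h1, h3]; abel
  · rw [star_add, add_mul, mul_add, mul_add, c3, c4, h2, h4]; abel

end MvNFacts

variable {A : Type*} [CStarAlgebra A] (F : FiniteTypeElements A)

/-- The set `Proj(F)` of projections in `F`. -/
def Proj : Type _ := {p : A // p ∈ F.carrier ∧ IsStarProjection p}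

instance : CoeOut F.Proj A := ⟨Subtype.val⟩

/-- Murray - von Neumann equivalence on `Proj(F)` (the partial isometry is taken in `A`). -/
instance projSetoid : Setoid F.Proj where
  r p q := MvN (p : A) (q : A)
  iseqv :=
    { refl := fun p => MvN.refl p.2.2
      symm := fun h => h.symm
      trans := fun {p _ r} h h' => h.trans p.2.2 r.2.2 h' }

/-- `S(F) = Proj(F) / ∼`. -/
def S : Type _ := Quotient F.projSetoid

variable {F}

/-- The sum of two orthogonal projections in `F`. -/
def Proj.orthoSum (p q : F.Proj) (h : (p : A) * (q : A) = 0) : F.Proj :=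
  ⟨(p : A) + (q : A), F.add_mem' p.2.1 q.2.1, p.2.2.add q.2.2 h⟩

theorem exists_orthogonal_equiv (p q : F.Proj) :
    ∃ q' : F.Proj, (p : A) * (q' : A) = 0 ∧ MvN (q : A) (q' : A) := by
  obtain ⟨v, h1, h2⟩ := F.exists_orthogonal' p p.2.1 q q.2.1 p.2.2 q.2.2
  have hproj : IsStarProjection (star v * v) :=
    isStarProjection_star_mul_self (by rw [h1]; exact q.2.2)
  have hv : v ∈ F.carrier := by
    rw [← mul_eq_self_of_projection q.2.2 h1]
    exact F.mul_mem_right' v q.2.1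
  exact ⟨⟨star v * v, F.mul_mem_left' _ hv, hproj⟩, mul_eq_zero_swap hproj p.2.2 h2, v, h1, rfl⟩

/-- A projection in `F` equivalent to `q` and orthogonal to `p`. -/
noncomputable def Proj.moveOff (p q : F.Proj) : F.Proj :=
  (exists_orthogonal_equiv p q).choose

theorem Proj.mul_moveOff (p q : F.Proj) : (p : A) * (p.moveOff q : A) = 0 :=
  (exists_orthogonal_equiv p q).choose_spec.1

theorem Proj.equiv_moveOff (p q : F.Proj) : MvN (q : A) (p.moveOff q : A) :=
  (exists_orthogonal_equiv p q).choose_spec.2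

/-- Addition on `S(F)`: `[p] + [q] = [p + q']`, where `q' ∈ Proj(F)` is any projection with
`q' ∼ q` and `q' ⟂ p` (see `mk_add_mk` for the independence of the choices). -/
noncomputable instance : Add F.S where
  add := Quotient.map₂ (fun p q => p.orthoSum (p.moveOff q) (p.mul_moveOff q)) (by
    intro p p' hp q q' hq
    refine MvN.add p.2.2 (p.moveOff q).2.2 p'.2.2 (p'.moveOff q').2.2 (p.mul_moveOff q)
      (p'.mul_moveOff q') hp ?_
    exact ((p.equiv_moveOff q).symm.trans (p.moveOff q).2.2 q'.2.2 hq).trans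
      (p.moveOff q).2.2 (p'.moveOff q').2.2 (p'.equiv_moveOff q'))

/-- The class of a projection in `S(F)`. -/
def S.mk (p : F.Proj) : F.S := Quotient.mk _ p

theorem S.mk_eq {p q : F.Proj} (h : MvN (p : A) (q : A)) : S.mk p = S.mk q :=
  Quotient.sound h

theorem S.mk_add_mk (p q : F.Proj) (h : (p : A) * (q : A) = 0) :
    S.mk p + S.mk q = S.mk (p.orthoSum q h) :=
  S.mk_eq (MvN.add p.2.2 (p.moveOff q).2.2 p.2.2 q.2.2 (p.mul_moveOff q) h (MvN.refl p.2.2)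
    (p.equiv_moveOff q).symm)

/-- The zero projection. -/
def Proj.zero : F.Proj := ⟨0, F.zero_mem', IsStarProjection.zero A⟩

instance : Zero F.S := ⟨S.mk Proj.zero⟩

theorem S.add_comm' (x y : F.S) : x + y = y + x := by
  induction x using Quotient.inductionOn with | _ p
  induction y using Quotient.inductionOn with | _ q
  change S.mk p + S.mk q = S.mk q + S.mk p
  have h := p.mul_moveOff q
  have h' := mul_eq_zero_swap p.2.2 (p.moveOff q).2.2 h
  rw [S.mk_eq (p.equiv_moveOff q), S.mk_add_mk _ _ h, S.mk_add_mk _ _ h']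
  congr 1
  exact Subtype.ext (add_comm _ _)

theorem S.zero_add' (x : F.S) : 0 + x = x := by
  induction x using Quotient.inductionOn with | _ p
  change S.mk Proj.zero + S.mk p = S.mk p
  rw [S.mk_add_mk Proj.zero p (zero_mul (p : A))]
  congr 1
  exact Subtype.ext (zero_add _)

theorem S.add_assoc' (x y z : F.S) : x + y + z = x + (y + z) := by
  induction x using Quotient.inductionOn with | _ p
  induction y using Quotient.inductionOn with | _ q
  induction z using Quotient.inductionOn with | _ r
  change S.mk p + S.mk q + S.mk r = S.mk p + (S.mk q + S.mk r)
  have h := p.mul_moveOff q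
  rw [S.mk_eq (p.equiv_moveOff q)]
  generalize p.moveOff q = q₁ at h
  rw [S.mk_add_mk _ _ h, S.mk_eq ((p.orthoSum q₁ h).equiv_moveOff r)]
  have h2 := (p.orthoSum q₁ h).mul_moveOff r
  generalize (p.orthoSum q₁ h).moveOff r = r₁ at h2
  have hpp : (p : A) * p = p := p.2.2.isIdempotentElem
  have hqq : (q₁ : A) * q₁ = q₁ := q₁.2.2.isIdempotentElem
  have h' := mul_eq_zero_swap p.2.2 q₁.2.2 h
  have h3 : ((p : A) + q₁) * r₁ = 0 := h2
  have hpr : (p : A) * r₁ = 0 := by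
    have : (p : A) * (((p : A) + q₁) * r₁) = 0 := by rw [h3, mul_zero]
    rwa [← mul_assoc, mul_add, hpp, h, add_zero] at this
  have hqr : (q₁ : A) * r₁ = 0 := by
    have : (q₁ : A) * (((p : A) + q₁) * r₁) = 0 := by rw [h3, mul_zero]
    rwa [← mul_assoc, mul_add, hqq, h', zero_add] at this
  have h4 : (p : A) * (q₁.orthoSum r₁ hqr : A) = 0 := by
    change (p : A) * ((q₁ : A) + r₁) = 0
    rw [mul_add, h, hpr, add_zero]
  rw [S.mk_add_mk _ _ h2, S.mk_add_mk _ _ hqr, S.mk_add_mk _ _ h4]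
  congr 1
  exact Subtype.ext (add_assoc _ _ _)

noncomputable instance : AddCommMonoid F.S where
  add_assoc := S.add_assoc'
  zero_add := S.zero_add'
  add_zero x := by rw [S.add_comm', S.zero_add']
  add_comm := S.add_comm'
  nsmul := nsmulRec

variable (F)

/-- `K(F)`: the Grothendieck group of `S(F)`. -/
abbrev K : Type _ := Algebra.GrothendieckAddGroup F.S

variable {F}

/-- The class `[p]` in `K(F)` of a projection `p ∈ F`. -/
noncomputable def cls (p : F.Proj) : F.K := Algebra.GrothendieckAddGroup.of (S.mk p)

/-- `b` is a `(p, q)`-inverse of `a`. -/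
structure IsAlmostInverse (a : A) (p q : F.Proj) (b : A) : Prop where
  eq_corner : b = (1 - (p : A)) * b * (1 - (q : A))
  mul_inv : ((1 - (q : A)) * a * (1 - (p : A))) * b = 1 - (q : A)
  inv_mul : b * ((1 - (q : A)) * a * (1 - (p : A))) = 1 - (p : A)

/-- `a` is invertible up to the pair of projections `(p, q)`. -/
def InvertibleUpTo (a : A) (p q : F.Proj) : Prop := ∃ b : A, IsAlmostInverse a p q b

variable (F)

/-- `a` is of Fredholm type: invertible up to some pair of projections in `F`. -/
def IsFredholm (a : A) : Prop := ∃ p q : F.Proj, InvertibleUpTo a p q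

variable {F}

/-- The index `[p] - [q] ∈ K(F)` of a Fredholm type element `a`, computed from some pair of
projections `(p, q)` in `F` up to which `a` is invertible. -/
noncomputable def index {a : A} (h : F.IsFredholm a) : F.K :=
  cls h.choose - cls h.choose_spec.choose

end FiniteTypeElements

/-! An element invertible up to `(p, q)` carries the complement of `p` isomorphically onto that of
`q`, so `[p] - [q]` plays the role of kernel minus cokernel. The index is controlled by moving the
first projection to a projection `e` of the approximate unit, in three steps packaged in
`InvertibleUpTo.exists_near`. If `e` almost contains `p`, some `p₁ ≥ p` is equivalent and close to
`e` (`exists_le_of_norm_le`). Replacing `p` by `p₁` adds to `q` a projection equivalent to `p₁ - p`,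
so the difference of classes is unchanged (`IsAlmostInverse.exists_of_le`). Finally `p₁` is replaced
by the nearby `e` through a Neumann series, which also tolerates a change of `a` that is small on
the complement of `e` (`IsAlmostInverse.invertibleUpTo_of_norm_lt`).

Two pairs for the same `a` can thus be given the same first projection; the second projections are
then complements of the same range, hence equivalent (`InvertibleUpTo.mvN`). Perturbations by `F`
become small off a suitable `e`, so they preserve the index. For a product, one `e` serves as first
projection of the left factor and second projection of the right one; the compressions compose,
their classes telescope, and the compressed product differs from the true one by an element of `F`.
-/

namespace FiniteTypeElements

/-! ### Polar decomposition and inverses in corners. -/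

section CStar

variable {A : Type*} [CStarAlgebra A]

/-- A bounded below element `x` of a C*-algebra with initial projection `e` has a polar part `v`,
whose final projection has the same range as the idempotent `x * y`. -/
theorem exists_polar {x y e : A} (he : IsStarProjection e) (hyx : y * x = e) (hxe : x * e = x) :
    ∃ v : A, star v * v = e ∧ IsStarProjection (v * star v) ∧ v * star v * x = x ∧
      x * y * (v * star v) = v * star v := by
  let _ := CStarAlgebra.spectralOrder A
  have _ := CStarAlgebra.spectralOrderedRing A
  have hee : e * e = e := he.isIdempotentElem
  have hes : star e = e := he.isSelfAdjoint
  have hex : e * star x = star x := by simpa [hes] using congrArg star hxe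
  have he' : star (1 - e) * (1 - e) = 1 - e := by
    rw [he.one_sub.isSelfAdjoint.star_eq, he.one_sub.isIdempotentElem.eq]
  have h1e : 0 ≤ 1 - e := he' ▸ star_mul_self_nonneg (1 - e)
  -- Adding `1 - e` makes `x* x` invertible in all of `A`, not only in the corner of `e`; the polar
  -- part is then `x z^(-1/2)`.
  set z := star x * x + (1 - e) with hz
  have hxx : 0 ≤ star x * x := star_mul_self_nonneg x
  have hz0 : 0 ≤ z := add_nonneg hxx h1e
  set N := ‖star y * y‖
  have hN : (0 : ℝ) < N + 1 := by positivity
  -- The bound `e = x* (y* y) x ≤ N x* x` handles the corner of `e`; the extra `1` in `N + 1`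
  -- handles `1 - e`.
  have hle : 1 ≤ (N + 1) • z := by
    have h1 : star x * (star y * y) * x ≤ N • (star x * x) :=
      CStarAlgebra.star_left_conjugate_le_norm_smul (IsSelfAdjoint.star_mul_self y)
    have h2 : star x * (star y * y) * x = e := by
      calc star x * (star y * y) * x = star (y * x) * (y * x) := by rw [star_mul]; noncomm_ring
        _ = e := by rw [hyx, hes, hee]
    rw [h2] at h1
    have h3 : 0 ≤ N • (1 - e) := smul_nonneg (norm_nonneg _) h1e
    calc (1 : A) = e + (1 - e) := by abel
      _ ≤ (N • (star x * x) + star x * x) + (N • (1 - e) + (1 - e)) :=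
        add_le_add (h1.trans (le_add_of_nonneg_right hxx)) (le_add_of_nonneg_left h3)
      _ = (N + 1) • z := by rw [hz, add_smul, one_smul, smul_add]; abel
  have hzu : IsUnit z := by
    have h : IsUnit ((Units.mk0 (N + 1) hN.ne') • z) := CStarAlgebra.isUnit_of_le 1 hle
    exact (isUnit_smul_iff _ _).1 h
  have hze : z * e = star x * x := by
    rw [hz, add_mul, mul_assoc, hxe, sub_mul, one_mul, hee, sub_self, add_zero]
  have hez : e * z = star x * x := by
    rw [hz, mul_add, ← mul_assoc, hex, mul_sub, mul_one, hee, sub_self, add_zero]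
  set d := CFC.sqrt z with hd
  have hdd : d * d = z := CFC.sqrt_mul_sqrt_self z hz0
  have hds : star d = d := (IsSelfAdjoint.of_nonneg (CFC.sqrt_nonneg z)).star_eq
  have hde : d * e = e * d := by
    have h : Commute z e := hze.trans hez.symm
    exact (h.cfcₙ_nnreal _).eq
  obtain ⟨u, hu⟩ : IsUnit d := (CFC.isUnit_sqrt_iff z hz0).2 hzu
  set c : A := ↑u⁻¹ with hc
  have hcd : c * d = 1 := by rw [← hu]; exact u.inv_mul
  have hdc : d * c = 1 := by rw [← hu]; exact u.mul_inv
  have hcs : star c = c := by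
    have h1 : d * star c = 1 := by simpa [hds] using congrArg star hcd
    calc star c = c * d * star c := by rw [hcd, one_mul]
      _ = c := by rw [mul_assoc, h1, mul_one]
  have hce : c * e = e * c := by
    calc c * e = c * (e * d) * c := by rw [mul_assoc, mul_assoc, hdc, mul_one]
      _ = e * c := by rw [← hde, ← mul_assoc, hcd, one_mul]
  have hv : star (x * c) * (x * c) = e := by
    calc star (x * c) * (x * c) = c * (star x * x) * c := by
          rw [star_mul, hcs]; noncomm_ring
      _ = c * d * (d * c) * e := by rw [← hze, ← hdd]; simp only [mul_assoc, hce]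
      _ = e := by rw [hcd, hdc, one_mul, one_mul]
  have hproj : IsStarProjection (x * c * star (x * c)) := by
    have := isStarProjection_star_mul_self (v := star (x * c)) (by rw [star_star, hv]; exact he)
    rwa [star_star] at this
  refine ⟨x * c, hv, hproj, ?_, ?_⟩
  · have h1 : x * c * star (x * c) * (x * c) = x * c := mul_eq_self_of_projection hproj rfl
    calc x * c * star (x * c) * x = x * c * star (x * c) * (x * c) * d := by
          rw [mul_assoc _ (x * c) d, mul_assoc x c d, hcd, mul_one]
      _ = x := by rw [h1, mul_assoc, hcd, mul_one]
  · calc x * y * (x * c * star (x * c)) = x * (y * x) * (c * star (x * c)) := by noncomm_ring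
      _ = x * c * star (x * c) := by rw [hyx, hxe]; noncomm_ring

/-- Algebraically equivalent projections are Murray - von Neumann equivalent. -/
theorem MvN.of_mul_eq {p q s t : A} (hp : IsStarProjection p) (hq : IsStarProjection q)
    (hst : s * t = p) (hts : t * s = q) (hs : s * q = s) : MvN p q := by
  obtain ⟨v, h1, h2, h3, h4⟩ := exists_polar hq hts hs
  refine ⟨v, ?_, h1⟩
  -- Each of the projections `v v*` and `p = s t` absorbs the other, so they coincide.
  have h5 : v * star v * p = p := by rw [← hst, ← mul_assoc, h3]
  rw [hst] at h4
  have h6 := congrArg star h5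
  rwa [star_mul, hp.isSelfAdjoint.star_eq, h2.isSelfAdjoint.star_eq, h4] at h6

/-- An element of a corner with an approximate inverse in the corner is invertible there. -/
theorem exists_corner_inverse {x y p q : A} (hp : p * p = p) (hq : q * q = q)
    (hqx : q * x = x) (hxp : x * p = x) (hpy : p * y = y) (hyq : y * q = y)
    (h1 : ‖q - x * y‖ < 1) (h2 : ‖p - y * x‖ < 1) :
    ∃ b : A, p * b = b ∧ b * q = b ∧ x * b = q ∧ b * x = p := by
  -- Neumann series in the whole algebra: `x y` and `y x` agree with the units `u` and `w` on the
  -- corners of `q` and `p`. This yields a right and a left inverse of `x`, which must be equal.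
  set u := Units.oneSub _ h1 with hu
  set w := Units.oneSub _ h2 with hw
  have hu1 : (u : A) = 1 - (q - x * y) := rfl
  have hw1 : (w : A) = 1 - (p - y * x) := rfl
  have hqu : x * y = u * q := by
    rw [hu1, sub_mul, sub_mul, one_mul, hq, mul_assoc, hyq]; abel
  have hqu' : x * y = q * u := by
    rw [hu1, mul_sub, mul_sub, mul_one, hq, ← mul_assoc, hqx]; abel
  have hwp : y * x = w * p := by
    rw [hw1, sub_mul, sub_mul, one_mul, hp, mul_assoc, hxp]; abel
  have hR : x * (y * ↑u⁻¹ * q) = q := by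
    rw [← mul_assoc, ← mul_assoc, hqu', Units.mul_inv_cancel_right, hq]
  have hL : (p * ↑w⁻¹ * y) * x = p := by
    rw [mul_assoc, hwp, mul_assoc, Units.inv_mul_cancel_left, hp]
  have hLR : p * ↑w⁻¹ * y = y * ↑u⁻¹ * q := by
    calc p * ↑w⁻¹ * y = p * ↑w⁻¹ * y * (x * (y * ↑u⁻¹ * q)) := by
          rw [hR, mul_assoc (p * _) y q, hyq]
      _ = y * ↑u⁻¹ * q := by
          rw [← mul_assoc, hL]; simp only [← mul_assoc]; rw [hpy]
  refine ⟨y * ↑u⁻¹ * q, ?_, ?_, hR, ?_⟩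
  · simp only [← mul_assoc, hpy]
  · rw [mul_assoc, hq]
  · rw [← hLR, hL]

theorem norm_projection_mul_le {p : A} (hp : IsStarProjection p) (x : A) : ‖p * x‖ ≤ ‖x‖ :=
  (norm_mul_le _ _).trans (mul_le_of_le_one_left (norm_nonneg _) hp.norm_le)

theorem norm_mul_projection_le {p : A} (hp : IsStarProjection p) (x : A) : ‖x * p‖ ≤ ‖x‖ :=
  (norm_mul_le _ _).trans (mul_le_of_le_one_right (norm_nonneg _) hp.norm_le)

end CStar

variable {A : Type*} [CStarAlgebra A] {F : FiniteTypeElements A}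

/-! ### Changing the first projection of an almost inverse. -/

theorem cls_eq {p q : F.Proj} (h : MvN (p : A) (q : A)) : cls p = cls q :=
  congrArg Algebra.GrothendieckAddGroup.of (S.mk_eq h)

theorem cls_orthoSum (p q : F.Proj) (h : (p : A) * (q : A) = 0) :
    cls (p.orthoSum q h) = cls p + cls q := by
  rw [cls, cls, cls, ← map_add, S.mk_add_mk p q h]

namespace IsAlmostInverse

variable {a b : A} {p q : F.Proj}

theorem mul_left_eq (h : IsAlmostInverse a p q b) : (1 - (p : A)) * b = b := by
  rw [h.eq_corner]
  simp only [← mul_assoc, p.2.2.one_sub.isIdempotentElem.eq]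

theorem mul_right_eq (h : IsAlmostInverse a p q b) : b * (1 - (q : A)) = b := by
  rw [h.eq_corner, mul_assoc, q.2.2.one_sub.isIdempotentElem.eq]

/-- Taking adjoints lets results about the first projection be applied to the second. -/
protected theorem star (h : IsAlmostInverse a p q b) : IsAlmostInverse (star a) q p (star b) := by
  have hp : star (1 - (p : A)) = 1 - (p : A) := p.2.2.one_sub.isSelfAdjoint
  have hq : star (1 - (q : A)) = 1 - (q : A) := q.2.2.one_sub.isSelfAdjoint
  refine ⟨?_, ?_, ?_⟩
  · have := congrArg star h.eq_corner
    rwa [star_mul, star_mul, hp, hq, ← mul_assoc] at this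
  · have := congrArg star h.inv_mul
    rwa [star_mul, star_mul, star_mul, hp, hq, ← mul_assoc (1 - (p : A))] at this
  · have := congrArg star h.mul_inv
    rwa [star_mul, star_mul, star_mul, hp, hq, ← mul_assoc (1 - (p : A))] at this

/-- Enlarging the initial projection does not change the index. -/
theorem exists_of_le (h : IsAlmostInverse a p q b) (p₁ : F.Proj) (hle : (p : A) * p₁ = p) :
    ∃ (q₁ : F.Proj) (b₁ : A), IsAlmostInverse a p₁ q₁ b₁ ∧ ‖b₁‖ ≤ ‖b‖ ∧
      cls p₁ - cls q₁ = cls p - cls q := by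
  obtain ⟨p, hpF, hp⟩ := p
  obtain ⟨q, hqF, hq⟩ := q
  obtain ⟨p₁, hpF₁, hp₁⟩ := p₁
  change p * p₁ = p at hle
  have hpp : p * p = p := hp.isIdempotentElem
  have hqq : q * q = q := hq.isIdempotentElem
  have hpp₁ : p₁ * p₁ = p₁ := hp₁.isIdempotentElem
  have hle' : p₁ * p = p := by
    simpa [hp.isSelfAdjoint.star_eq, hp₁.isSelfAdjoint.star_eq] using congrArg star hle
  have hd : IsStarProjection (p₁ - p) :=
    ⟨by change (p₁ - p) * (p₁ - p) = p₁ - p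
        rw [mul_sub, sub_mul, sub_mul, hpp₁, hle, hle', hpp]; abel,
      hp₁.isSelfAdjoint.sub hp.isSelfAdjoint⟩
  have hdF : p₁ - p ∈ F.carrier := by
    have := F.mul_mem_left' (1 - p) hpF₁
    rwa [sub_mul, one_mul, hle] at this
  have hb1 : (1 - p) * b = b := h.mul_left_eq
  have hb2 : b * (1 - q) = b := h.mul_right_eq
  have hab : (1 - q) * a * (1 - p) * b = 1 - q := h.mul_inv
  have hba : b * ((1 - q) * a * (1 - p)) = 1 - p := h.inv_mul
  set a' := (1 - q) * a * (1 - p) with ha'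
  have hqa : q * a' = 0 := by
    rw [ha', ← mul_assoc, ← mul_assoc, mul_sub q 1 q, mul_one, hqq, sub_self, zero_mul, zero_mul]
  have hpd : (1 - p) * (p₁ - p) = p₁ - p := by
    rw [sub_mul, one_mul, mul_sub, hle, hpp]; abel
  have hd1 : (1 - p₁) * (p₁ - p) = 0 := by
    rw [sub_mul, one_mul, mul_sub, hle', hpp₁]; abel
  -- `a'` is injective on the range of `p₁ - p`. The range projection `r` of its image there is
  -- equivalent to `p₁ - p` and orthogonal to `q`, and `q + r` is the new second projection.
  have hyx : (p₁ - p) * b * (a' * (p₁ - p)) = p₁ - p := by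
    calc (p₁ - p) * b * (a' * (p₁ - p)) = (p₁ - p) * ((b * a') * (p₁ - p)) := by noncomm_ring
      _ = p₁ - p := by rw [hba, hpd]; exact hd.isIdempotentElem
  obtain ⟨v, hv, hr, hrx, hxr⟩ := exists_polar hd hyx
    (by rw [mul_assoc, show (p₁ - p) * (p₁ - p) = p₁ - p from hd.isIdempotentElem])
  set r := v * star v with hrdef
  clear_value r
  have hrF : r ∈ F.carrier := by
    rw [← hxr]
    exact F.mul_mem_right' _ (F.mul_mem_right' _ (F.mul_mem_left' _ hdF))
  have hqr : q * r = 0 := by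
    rw [← hxr]
    simp only [← mul_assoc, hqa, zero_mul]
  have hrq : r * q = 0 := mul_eq_zero_swap hq hr hqr
  let Q : F.Proj := ⟨q, hqF, hq⟩
  let R : F.Proj := ⟨r, hrF, hr⟩
  let P : F.Proj := ⟨p, hpF, hp⟩
  let D : F.Proj := ⟨p₁ - p, hdF, hd⟩
  have hPD : p * (p₁ - p) = 0 := by rw [mul_sub, hle, hpp, sub_self]
  have hq₁ : IsStarProjection (q + r) := hq.add hr hqr
  have e1 : (1 - (q + r)) * (1 - q) = 1 - (q + r) := by
    rw [sub_mul, one_mul, mul_sub, mul_one, add_mul, hqq, hrq]; abel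
  have e2 : (1 - p) * (1 - p₁) = 1 - p₁ := by
    rw [mul_sub, mul_one, sub_mul, one_mul, hle]; abel
  have e3 : (1 - (q + r)) * a * (1 - p₁) = (1 - (q + r)) * a' * (1 - p₁) := by
    calc (1 - (q + r)) * a * (1 - p₁)
        = ((1 - (q + r)) * (1 - q)) * a * ((1 - p) * (1 - p₁)) := by rw [e1, e2]
      _ = _ := by rw [ha']; simp only [mul_assoc]
  have i1 : (1 - (q + r)) * (1 - (q + r)) = 1 - (q + r) := hq₁.one_sub.isIdempotentElem
  have i2 : (1 - p₁) * (1 - p₁) = 1 - p₁ := hp₁.one_sub.isIdempotentElem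
  refine ⟨Q.orthoSum R hqr, (1 - p₁) * b * (1 - (q + r)), ⟨?_, ?_, ?_⟩, ?_, ?_⟩
  · change (1 - p₁) * b * (1 - (q + r))
      = (1 - p₁) * ((1 - p₁) * b * (1 - (q + r))) * (1 - (q + r))
    simp only [mul_assoc, i1]
    rw [← mul_assoc (1 - p₁) (1 - p₁), i2]
  · change (1 - (q + r)) * a * (1 - p₁) * ((1 - p₁) * b * (1 - (q + r))) = 1 - (q + r)
    have f1 : a' * (1 - p₁) * b = (1 - q) - a' * (p₁ - p) * b := by
      rw [← hab]
      nth_rw 2 [← hb1]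
      noncomm_ring
    have f2 : (1 - (q + r)) * (a' * (p₁ - p) * b) = 0 := by
      rw [sub_mul, add_mul, one_mul, ← mul_assoc r, hrx, ← mul_assoc q, ← mul_assoc q, hqa]
      simp
    calc (1 - (q + r)) * a * (1 - p₁) * ((1 - p₁) * b * (1 - (q + r)))
        = (1 - (q + r)) * (a' * ((1 - p₁) * (1 - p₁)) * b) * (1 - (q + r)) := by
          rw [e3]; simp only [mul_assoc]
      _ = 1 - (q + r) := by rw [i2, f1, mul_sub _ _ (a' * (p₁ - p) * b), f2, sub_zero, e1, i1]
  · change (1 - p₁) * b * (1 - (q + r)) * ((1 - (q + r)) * a * (1 - p₁)) = 1 - p₁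
    -- `b` maps the range of `r` back into that of `p₁ - p`, which `1 - p₁` kills; so cutting `b` by
    -- `1 - (q + r)` on the right changes nothing after cutting by `1 - p₁` on the left.
    have f1 : b * r = (p₁ - p) * b * r := by
      conv_lhs => rw [← hxr]
      calc b * (a' * (p₁ - p) * ((p₁ - p) * b) * r)
          = (b * a') * (((p₁ - p) * (p₁ - p)) * (b * r)) := by simp only [mul_assoc]
        _ = (p₁ - p) * b * r := by
          rw [hba, hd.isIdempotentElem.eq, ← mul_assoc (1 - p), hpd, mul_assoc]
    have f2 : (1 - p₁) * b * (1 - (q + r)) = (1 - p₁) * b := by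
      have : b * q = 0 := by
        rw [← hb2, mul_assoc, sub_mul, one_mul, hqq, sub_self, mul_zero]
      rw [mul_sub, mul_one, mul_add, mul_assoc _ b q, mul_assoc _ b r, this, f1, mul_assoc _ b r,
        ← mul_assoc (1 - p₁) (p₁ - p), hd1]
      simp
    calc (1 - p₁) * b * (1 - (q + r)) * ((1 - (q + r)) * a * (1 - p₁))
        = (1 - p₁) * b * (1 - (q + r)) * ((1 - (q + r)) * a' * (1 - p₁)) := by rw [e3]
      _ = (1 - p₁) * b * ((1 - (q + r)) * (1 - (q + r))) * a' * (1 - p₁) := by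
          simp only [mul_assoc]
      _ = (1 - p₁) * ((b * a') * (1 - p₁)) := by rw [i1, f2]; simp only [mul_assoc]
      _ = 1 - p₁ := by rw [hba, e2, i2]
  · exact (norm_mul_projection_le hq₁.one_sub _).trans (norm_projection_mul_le hp₁.one_sub _)
  · have h1 : cls (⟨p₁, hpF₁, hp₁⟩ : F.Proj) = cls P + cls D := by
      rw [← cls_orthoSum P D hPD]
      congr 1
      exact Subtype.ext (by change p₁ = p + (p₁ - p); abel)
    have h2 : cls R = cls D := cls_eq ⟨v, hrdef.symm, hv⟩
    rw [h1, cls_orthoSum, h2]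
    change cls P + cls D - (cls Q + cls D) = cls P - cls Q
    abel

/-- Almost invertibility is stable under small perturbations of the element and of the initial
projection. -/
theorem invertibleUpTo_of_norm_lt (h : IsAlmostInverse a p q b) {a' : A} {e : F.Proj}
    (hlt : ‖b‖ * (‖(a' - a) * (1 - (e : A))‖ + ‖a‖ * ‖(p : A) - e‖) + ‖(p : A) - e‖ < 1) :
    InvertibleUpTo a' e q := by
  have he := e.2.2.one_sub
  have hq := q.2.2.one_sub
  have hee : (1 - (e : A)) * (1 - (e : A)) = 1 - (e : A) := he.isIdempotentElem
  have hqq : (1 - (q : A)) * (1 - (q : A)) = 1 - (q : A) := hq.isIdempotentElem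
  have hD : ‖a * (1 - (p : A)) - a' * (1 - (e : A))‖ ≤
      ‖(a' - a) * (1 - (e : A))‖ + ‖a‖ * ‖(p : A) - e‖ := by
    have : a * (1 - (p : A)) - a' * (1 - (e : A))
        = -((a' - a) * (1 - (e : A)) + a * ((p : A) - e)) := by noncomm_ring
    rw [this, norm_neg]
    exact (norm_add_le _ _).trans (by gcongr; exact norm_mul_le _ _)
  set D := a * (1 - (p : A)) - a' * (1 - (e : A)) with hDdef
  have hbD : ‖b‖ * ‖D‖ + ‖(p : A) - e‖ < 1 := by
    refine lt_of_le_of_lt ?_ hlt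
    gcongr
  have h1 : (1 - (q : A)) - (1 - (q : A)) * a' * (1 - (e : A)) * ((1 - (e : A)) * b)
      = (1 - (q : A)) * (D * b) := by
    have t1 : (1 - (q : A)) * a' * (1 - (e : A)) * ((1 - (e : A)) * b)
        = (1 - (q : A)) * (a' * (1 - (e : A)) * b) := by
      simp only [mul_assoc]
      rw [← mul_assoc (1 - (e : A)) (1 - (e : A)) b, hee]
    have t2 : (1 - (q : A)) * (a * (1 - (p : A)) * b) = 1 - (q : A) := by
      simpa only [mul_assoc] using h.mul_inv
    rw [t1, hDdef, sub_mul (a * (1 - (p : A))) (a' * (1 - (e : A))) b,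
      mul_sub (1 - (q : A)) (a * (1 - (p : A)) * b) (a' * (1 - (e : A)) * b), t2]
  have h2 : (1 - (e : A)) - (1 - (e : A)) * b * ((1 - (q : A)) * a' * (1 - (e : A)))
      = (1 - (e : A)) * ((b * ((1 - (q : A)) * D) + ((p : A) - e)) * (1 - (e : A))) := by
    have : b * ((1 - (q : A)) * D) + ((p : A) - e)
        = (1 - (e : A)) - b * ((1 - (q : A)) * a' * (1 - (e : A))) := by
      rw [hDdef, mul_sub, mul_sub, ← mul_assoc (1 - (q : A)) a, h.inv_mul]
      simp only [mul_assoc]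
      abel
    rw [this, sub_mul (1 - (e : A)) (b * _) (1 - (e : A)), hee,
      mul_sub (1 - (e : A)) (1 - (e : A)) _, hee]
    congr 1
    simp only [mul_assoc, hee]
  -- `(1 - e) b` is the approximate inverse; `h1` and `h2` express its two errors through `D` and `p
  -- - e`.
  obtain ⟨c, hc1, hc2, hc3, hc4⟩ := exists_corner_inverse
    (x := (1 - (q : A)) * a' * (1 - (e : A))) (y := (1 - (e : A)) * b) hee hqq
    (by simp only [← mul_assoc, hqq]) (by rw [mul_assoc, hee]) (by rw [← mul_assoc, hee])
    (by rw [mul_assoc, h.mul_right_eq])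
    (by
      rw [h1]
      refine (norm_projection_mul_le hq _).trans_lt ((norm_mul_le _ _).trans_lt ?_)
      rw [mul_comm]
      exact lt_of_le_of_lt (le_add_of_nonneg_right (norm_nonneg _)) hbD)
    (by
      rw [h2]
      refine (norm_projection_mul_le he _).trans_lt ((norm_mul_projection_le he _).trans_lt ?_)
      refine (norm_add_le _ _).trans_lt (lt_of_le_of_lt ?_ hbD)
      gcongr
      exact (norm_mul_le _ _).trans (by gcongr; exact norm_projection_mul_le hq _))
  exact ⟨c, by rw [hc1, hc2], hc3, hc4⟩

end IsAlmostInverse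

/-! ### Moving to a projection of the approximate unit. -/

/-- If a projection `p` is almost contained in `e`, then it is contained in a projection which is
equivalent to `e` and close to it. -/
theorem exists_le_of_norm_le {p e : F.Proj} {δ : ℝ} (hδ : δ ≤ 1 / 2)
    (h : ‖(1 - (e : A)) * p‖ ≤ δ) :
    ∃ r : F.Proj, (p : A) * r = p ∧ MvN (r : A) (e : A) ∧ ‖(r : A) - e‖ ≤ 10 * δ := by
  obtain ⟨p, hpF, hp⟩ := p
  obtain ⟨e, heF, he⟩ := e
  change ‖(1 - e) * p‖ ≤ δ at h
  have hee : e * e = e := he.isIdempotentElem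
  have hpp : p * p = p := hp.isIdempotentElem
  set t := (1 - e) * p with ht
  have hδ0 : 0 ≤ δ := (norm_nonneg _).trans h
  -- Since `g p = e p`, the idempotent `g⁻¹ e g`, similar to `e`, fixes `p`. Its range projection is
  -- the required `r`.
  set g := Units.oneSub t (by linarith) with hgdef
  have hg : (g : A) = 1 - t := rfl
  set k : A := ↑g⁻¹ with hkdef
  have hkg : k * g = 1 := g.inv_mul
  have hgk : (g : A) * k = 1 := g.mul_inv
  have h1 : ‖(1 : A)‖ ≤ 1 := (IsStarProjection.one A).norm_le
  have hgn : ‖(g : A)‖ ≤ 2 := by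
    rw [hg]
    exact (norm_sub_le _ _).trans (by linarith)
  have hk : k = 1 + k * t := by
    have : k * (1 - t) = 1 := hkg
    rw [mul_sub, mul_one] at this
    rw [← this]; abel
  have hkn : ‖k‖ ≤ 2 := by
    have h2 : ‖k‖ ≤ ‖(1 : A)‖ + ‖k * t‖ := by
      conv_lhs => rw [hk]
      exact norm_add_le _ _
    have h3 : ‖k * t‖ ≤ ‖k‖ * (1 / 2) :=
      (norm_mul_le _ _).trans (by gcongr; linarith)
    linarith
  have hyx : e * g * (k * e) = e := by
    rw [mul_assoc, ← mul_assoc (g : A), hgk, one_mul, hee]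
  obtain ⟨v, hv, hr, hrx, hxr⟩ := exists_polar he hyx (by rw [mul_assoc, hee])
  set r := v * star v with hrdef
  clear_value r
  have hxy : k * e * (e * g) = k * e * g := by
    rw [mul_assoc, ← mul_assoc e, hee, ← mul_assoc]
  rw [hxy] at hxr
  have hrk : r * (k * e * g) = k * e * g := by rw [← mul_assoc, hrx]
  have hclose : ‖k * e * g - e‖ ≤ 5 * δ := by
    have e1 : k * e * g - e = k * t * (e * g) - e * t := by
      conv_lhs => rw [hk, add_mul, one_mul, add_mul]
      rw [hg]
      noncomm_ring
    have e2 : ‖k * t * (e * g)‖ ≤ 2 * δ * 2 :=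
      (norm_mul_le _ _).trans (mul_le_mul
        ((norm_mul_le _ _).trans (mul_le_mul hkn h (norm_nonneg _) zero_le_two))
        ((norm_projection_mul_le he _).trans hgn) (norm_nonneg _) (by positivity))
    have e3 : ‖e * t‖ ≤ δ := (norm_projection_mul_le he _).trans h
    rw [e1]
    exact (norm_sub_le _ _).trans (by linarith)
  have hrF : r ∈ F.carrier := by
    rw [← hxr]
    exact F.mul_mem_right' _ (F.mul_mem_right' _ (F.mul_mem_left' _ heF))
  refine ⟨⟨r, hrF, hr⟩, ?_, ⟨v, hrdef.symm, hv⟩, ?_⟩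
  · have e1 : (g : A) * p = e * p := by
      rw [hg, ht, sub_mul, one_mul, mul_assoc, hpp]; noncomm_ring
    have e2 : k * e * p = p := by rw [mul_assoc, ← e1, ← mul_assoc, hkg, one_mul]
    have e3 : r * p = p := by rw [← e2, ← mul_assoc, hrx]
    change p * r = p
    simpa [hp.isSelfAdjoint.star_eq, hr.isSelfAdjoint.star_eq] using congrArg star e3
  · change ‖r - e‖ ≤ 10 * δ
    have e1 : (1 - r) * e = (1 - r) * (e - k * e * g) := by
      rw [mul_sub, sub_mul _ _ (k * e * g), hrk, one_mul, sub_self, sub_zero]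
    have e2 : (1 - e) * r = (1 - e) * (k * e * g - e) * r := by
      have : (1 - e) * e = 0 := by rw [sub_mul, one_mul, hee, sub_self]
      rw [mul_sub, this, sub_zero, mul_assoc, hxr]
    have n1 : ‖(1 - r) * e‖ ≤ 5 * δ := by
      rw [e1]
      exact (norm_projection_mul_le hr.one_sub _).trans (by rwa [norm_sub_rev])
    have n2 : ‖r * (1 - e)‖ ≤ 5 * δ := by
      rw [← norm_star, star_mul, hr.isSelfAdjoint.star_eq, he.one_sub.isSelfAdjoint.star_eq, e2]
      exact (norm_mul_projection_le hr _).trans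
        ((norm_projection_mul_le he.one_sub _).trans hclose)
    -- Both terms are at most `5 * δ` because `g⁻¹ e g` has the same range as `r` and is that close
    -- to `e`.
    have e3 : r - e = r * (1 - e) - (1 - r) * e := by noncomm_ring
    rw [e3]
    exact (norm_sub_le _ _).trans (by linarith)

/-- An element invertible up to `(p, q)` is, after a perturbation which is small on the complement
of `e`, invertible up to `(e, q₁)` for some `q₁`, as soon as `e` almost contains `p`, and the pair
`(e, q₁)` gives the same index. -/
theorem InvertibleUpTo.exists_near {a : A} {p q : F.Proj} (h : InvertibleUpTo a p q) :
    ∃ δ > 0, ∀ (e : F.Proj) (a' : A), ‖(1 - (e : A)) * p‖ < δ →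
      ‖(a' - a) * (1 - (e : A))‖ < δ →
      ∃ q₁ : F.Proj, InvertibleUpTo a' e q₁ ∧ cls e - cls q₁ = cls p - cls q := by
  obtain ⟨b, h⟩ := h
  -- `M * δ` is the perturbation bound when `p₁` is within `10 * δ` of `e`. It can be fixed in
  -- advance because enlarging `p` to `p₁` does not increase the norm of the almost inverse. The
  -- summand `10` also forces `δ ≤ 1 / 2`.
  set M := ‖b‖ * (1 + ‖a‖ * 10) + 10 with hM
  have hM10 : 10 ≤ M := le_add_of_nonneg_left (by positivity)
  set δ := 1 / (M + 1) with hδ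
  have hδ0 : 0 < δ := by positivity
  have hδM : M * δ < 1 := by
    rw [hδ, mul_one_div, div_lt_one (by positivity)]
    linarith
  refine ⟨δ, hδ0, fun e a' hep ha' => ?_⟩
  obtain ⟨p₁, hp₁, hpe, hn⟩ := exists_le_of_norm_le (δ := δ) (by nlinarith) hep.le
  obtain ⟨q₁, b₁, hb₁, hbn, hcls⟩ := h.exists_of_le p₁ hp₁
  refine ⟨q₁, hb₁.invertibleUpTo_of_norm_lt (e := e) (a' := a') (lt_of_le_of_lt ?_ hδM), ?_⟩
  · calc ‖b₁‖ * (‖(a' - a) * (1 - (e : A))‖ + ‖a‖ * ‖(p₁ : A) - e‖) + ‖(p₁ : A) - e‖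
        ≤ ‖b‖ * (δ + ‖a‖ * (10 * δ)) + 10 * δ := by gcongr
      _ = M * δ := by rw [hM]; ring
  · rw [← cls_eq hpe, hcls]

theorem exists_proj_norm_lt {x y : A} (hx : x ∈ F.carrier) (hy : y ∈ F.carrier) {δ ε : ℝ}
    (hδ : 0 < δ) (hε : 0 < ε) :
    ∃ e : F.Proj, ‖(1 - (e : A)) * x‖ < δ ∧ ‖(1 - (e : A)) * y‖ < ε := by
  obtain ⟨l, hl, hproj⟩ := F.exists_approximateUnit'
  have := hl.neBot
  have key (z : F.toNonUnitalStarSubalgebra) {ε : ℝ} (hε : 0 < ε) :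
      ∀ᶠ e : F.toNonUnitalStarSubalgebra in l, ‖(1 - (e : A)) * (z : A)‖ < ε := by
    filter_upwards [Metric.tendsto_nhds.1 (hl.tendsto_mul_right z) ε hε] with e he
    rw [Subtype.dist_eq, dist_comm, dist_eq_norm] at he
    simpa [sub_mul] using he
  obtain ⟨e, h1, h2, h3⟩ := (hproj.and ((key ⟨x, hx⟩ hδ).and (key ⟨y, hy⟩ hε))).exists
  exact ⟨⟨e, e.2, h1⟩, h2, h3⟩

protected theorem InvertibleUpTo.star {a : A} {p q : F.Proj} (h : InvertibleUpTo a p q) :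
    InvertibleUpTo (star a) q p :=
  h.elim fun _ hb => ⟨_, hb.star⟩

/-! ### Independence of the pair of projections. -/

/-- The second projection is determined by the first up to equivalence. -/
theorem InvertibleUpTo.mvN {a : A} {p q q' : F.Proj} (h : InvertibleUpTo a p q)
    (h' : InvertibleUpTo a p q') : MvN (q : A) (q' : A) := by
  have key {q : F.Proj} {b : A} (hb : IsAlmostInverse a p q b) :
      b * (a * (1 - (p : A))) = 1 - (p : A) ∧
      (q : A) * (1 - a * (1 - (p : A)) * b) = 1 - a * (1 - (p : A)) * b ∧
      (1 - a * (1 - (p : A)) * b) * q = q := by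
    have hqq : (q : A) * q = q := q.2.2.isIdempotentElem
    refine ⟨?_, ?_, ?_⟩
    · conv_lhs => rw [← hb.mul_right_eq]
      simpa only [mul_assoc] using hb.inv_mul
    · have h0 : (1 - (q : A)) * (1 - a * (1 - (p : A)) * b) = 0 := by
        have h1 := hb.mul_inv
        simp only [mul_assoc] at h1
        rw [mul_sub, mul_one, mul_assoc a, h1, sub_self]
      rw [sub_mul, one_mul] at h0
      exact (sub_eq_zero.1 h0).symm
    · have h0 : b * (q : A) = 0 := by
        rw [← hb.mul_right_eq, mul_assoc, sub_mul, one_mul, hqq, sub_self, mul_zero]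
      rw [sub_mul, one_mul, mul_assoc _ b, h0, mul_zero, sub_zero]
  obtain ⟨b, hb⟩ := h
  obtain ⟨b', hb'⟩ := h'
  obtain ⟨h1, h2, h3⟩ := key hb
  obtain ⟨h1', h2', h3'⟩ := key hb'
  have hpp : a * (1 - (p : A)) * (1 - (p : A)) = a * (1 - (p : A)) := by
    rw [mul_assoc, p.2.2.one_sub.isIdempotentElem.eq]
  set x := a * (1 - (p : A)) with hx
  -- The idempotents `1 - x b` and `1 - x b'` have the ranges of `q` and `q'` and the same kernel,
  -- the range of `x`. Hence each restricts to an isomorphism from the range of the other.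
  have hf : (1 - x * b) * (1 - x * b') = 1 - x * b := by
    rw [mul_sub, mul_one, ← mul_assoc, sub_mul 1 _ x, one_mul, mul_assoc x b x, h1, hpp, sub_self,
      zero_mul, sub_zero]
  have hf' : (1 - x * b') * (1 - x * b) = 1 - x * b' := by
    rw [mul_sub, mul_one, ← mul_assoc, sub_mul 1 _ x, one_mul, mul_assoc x b' x, h1', hpp,
      sub_self, zero_mul, sub_zero]
  refine MvN.of_mul_eq q.2.2 q'.2.2 (s := (1 - x * b) * q') (t := (1 - x * b') * q) ?_ ?_ ?_
  · rw [mul_assoc, ← mul_assoc (q' : A), h2', ← mul_assoc, hf, h3]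
  · rw [mul_assoc, ← mul_assoc (q : A), h2, ← mul_assoc, hf', h3']
  · rw [mul_assoc, q'.2.2.isIdempotentElem.eq]

theorem InvertibleUpTo.cls_sub_eq {a : A} {p q p' q' : F.Proj} (h : InvertibleUpTo a p q)
    (h' : InvertibleUpTo a p' q') : cls p - cls q = cls p' - cls q' := by
  obtain ⟨δ, hδ, H⟩ := h.exists_near
  obtain ⟨δ', hδ', H'⟩ := h'.exists_near
  obtain ⟨e, he, he'⟩ := exists_proj_norm_lt p.2.1 p'.2.1 hδ hδ'
  obtain ⟨q₁, h₁, hc⟩ := H e a he (by simpa using hδ)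
  obtain ⟨q₁', h₁', hc'⟩ := H' e a he' (by simpa using hδ')
  rw [← hc, ← hc', cls_eq (h₁.mvN h₁')]

/-! ### Perturbations by `F` and products. -/

/-- The index is invariant under perturbations by elements of `F`. -/
theorem InvertibleUpTo.exists_of_sub_mem {a a' : A} {p q : F.Proj} (h : InvertibleUpTo a p q)
    (hsub : a' - a ∈ F.carrier) :
    ∃ p' q' : F.Proj, InvertibleUpTo a' p' q' ∧ cls p' - cls q' = cls p - cls q := by
  obtain ⟨δ, hδ, H⟩ := h.exists_near
  -- The adjoint turns smallness of `(1 - e) (a' - a)*` into the required smallness of `(a' - a) (1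
  -- - e)`.
  obtain ⟨e, he, he'⟩ := exists_proj_norm_lt p.2.1 (F.star_mem' hsub) hδ hδ
  refine ⟨e, H e a' he ?_⟩
  rwa [← norm_star, star_mul, e.2.2.one_sub.isSelfAdjoint.star_eq]

theorem InvertibleUpTo.comp {a a' : A} {p q r : F.Proj} (h : InvertibleUpTo a p q)
    (h' : InvertibleUpTo a' r p) :
    InvertibleUpTo ((1 - (q : A)) * (a * (1 - (p : A)) * a') * (1 - (r : A))) r q := by
  obtain ⟨b, hb⟩ := h
  obtain ⟨b', hb'⟩ := h'
  have hpp : (1 - (p : A)) * (1 - (p : A)) = 1 - (p : A) := p.2.2.one_sub.isIdempotentElem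
  have hqq : (1 - (q : A)) * (1 - (q : A)) = 1 - (q : A) := q.2.2.one_sub.isIdempotentElem
  have hrr : (1 - (r : A)) * (1 - (r : A)) = 1 - (r : A) := r.2.2.one_sub.isIdempotentElem
  have hx : (1 - (q : A)) * ((1 - (q : A)) * (a * (1 - (p : A)) * a') * (1 - (r : A))) *
      (1 - (r : A)) = ((1 - (q : A)) * a * (1 - (p : A))) * ((1 - (p : A)) * a' * (1 - (r : A))) := by
    calc _ = ((1 - (q : A)) * (1 - (q : A))) * a * (1 - (p : A)) * a' *
          ((1 - (r : A)) * (1 - (r : A))) := by simp only [mul_assoc]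
      _ = (1 - (q : A)) * a * ((1 - (p : A)) * (1 - (p : A))) * a' * (1 - (r : A)) := by
          rw [hqq, hrr, hpp]
      _ = _ := by simp only [mul_assoc]
  refine ⟨b' * b, ?_, ?_, ?_⟩
  · rw [← mul_assoc, hb'.mul_left_eq, mul_assoc, hb.mul_right_eq]
  · rw [hx, mul_assoc, ← mul_assoc _ b' b, hb'.mul_inv, hb.mul_left_eq, hb.mul_inv]
  · rw [hx, mul_assoc, ← mul_assoc b, hb.inv_mul]
    simp only [← mul_assoc]
    rw [mul_assoc b', hpp]
    simpa only [mul_assoc] using hb'.inv_mul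

theorem InvertibleUpTo.exists_mul {a a' : A} {p q r s : F.Proj} (h : InvertibleUpTo a p q)
    (h' : InvertibleUpTo a' r s) :
    ∃ p' q' : F.Proj, InvertibleUpTo (a * a') p' q' ∧
      cls p' - cls q' = (cls p - cls q) + (cls r - cls s) := by
  obtain ⟨δ, hδ, H⟩ := h.exists_near
  -- Passing to `star a'` makes `s` the first projection, so that `p` and `s` can be moved to a
  -- common `e`.
  obtain ⟨δ', hδ', H'⟩ := h'.star.exists_near
  obtain ⟨e, he, he'⟩ := exists_proj_norm_lt p.2.1 s.2.1 hδ hδ'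
  obtain ⟨q₁, h₁, hc⟩ := H e a he (by simpa using hδ)
  obtain ⟨r₁, h₂, hc'⟩ := H' e (star a') he' (by simpa using hδ')
  have h₃ : InvertibleUpTo a' r₁ e := by simpa using h₂.star
  have hsub : a * a' - (1 - (q₁ : A)) * (a * (1 - (e : A)) * a') * (1 - (r₁ : A)) ∈ F.carrier := by
    have : a * a' - (1 - (q₁ : A)) * (a * (1 - (e : A)) * a') * (1 - (r₁ : A))
        = a * (e : A) * a' + q₁ * (a * (1 - (e : A)) * a')
          + (1 - (q₁ : A)) * (a * (1 - (e : A)) * a') * r₁ := by noncomm_ring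
    rw [this]
    exact F.add_mem' (F.add_mem' (F.mul_mem_right' _ (F.mul_mem_left' _ e.2.1))
      (F.mul_mem_right' _ q₁.2.1)) (F.mul_mem_left' _ r₁.2.1)
  obtain ⟨p', q', hpq, hcls⟩ := (h₁.comp h₃).exists_of_sub_mem hsub
  refine ⟨p', q', hpq, ?_⟩
  rw [hcls, ← hc, ← neg_sub (cls s), ← hc']
  abel

/-! ### The index homomorphism. -/

theorem index_eq {a : A} (h : F.IsFredholm a) {p q : F.Proj} (hpq : InvertibleUpTo a p q) :
    index h = cls p - cls q :=
  InvertibleUpTo.cls_sub_eq h.choose_spec.choose_spec hpq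

theorem invertibleUpTo_one : InvertibleUpTo (1 : A) (Proj.zero : F.Proj) Proj.zero :=
  have h0 : ((Proj.zero : F.Proj) : A) = 0 := rfl
  ⟨1, by simp [h0], by simp [h0], by simp [h0]⟩

theorem exists_index_mul {a a' : A} (h : F.IsFredholm a) (h' : F.IsFredholm a') :
    ∃ hm : F.IsFredholm (a * a'), index hm = index h + index h' := by
  obtain ⟨p, q, hpq, hcls⟩ :=
    InvertibleUpTo.exists_mul h.choose_spec.choose_spec h'.choose_spec.choose_spec
  exact ⟨⟨p, q, hpq⟩, (index_eq _ hpq).trans hcls⟩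

variable (F) in
/-- The monoid of Fredholm type elements. -/
def fredholmSubmonoid : Submonoid A where
  carrier := {a | F.IsFredholm a}
  one_mem' := ⟨_, _, invertibleUpTo_one⟩
  mul_mem' h h' := (exists_index_mul h h').1

variable (F) in
/-- The index as a monoid homomorphism. -/
noncomputable def indexHom : F.fredholmSubmonoid →* Multiplicative F.K where
  toFun a := Multiplicative.ofAdd (index a.2)
  map_one' := by
    have h : index (F.fredholmSubmonoid).one_mem = 0 :=
      (index_eq _ invertibleUpTo_one).trans (sub_self _)
    exact congrArg Multiplicative.ofAdd h
  map_mul' a a' := congrArg Multiplicative.ofAdd (exists_index_mul a.2 a'.2).2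

end FiniteTypeElements

theorem mainTheorem1 {A : Type*} [CStarAlgebra A] (F : FiniteTypeElements A) :
    -- the index does not depend on the pair of projections from which it is computed
    (∀ (a : A) (h : F.IsFredholm a) (p q : F.Proj), FiniteTypeElements.InvertibleUpTo a p q →
      FiniteTypeElements.index h = FiniteTypeElements.cls p - FiniteTypeElements.cls q) ∧
    -- the index theorem
    (∀ (t₁ t₂ : A) (h₁ : F.IsFredholm t₁) (h₂ : F.IsFredholm t₂),
      ∃ h : F.IsFredholm (t₁ * t₂),
        FiniteTypeElements.index h = FiniteTypeElements.index h₁ + FiniteTypeElements.index h₂) ∧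
    -- the Fredholm type elements form a monoid, on which the index is a homomorphism
    (∃ M : Submonoid A, (∀ a : A, a ∈ M ↔ F.IsFredholm a) ∧
      ∃ φ : M →* Multiplicative F.K, ∀ (a : A) (ha : a ∈ M) (h : F.IsFredholm a),
        φ ⟨a, ha⟩ = Multiplicative.ofAdd (FiniteTypeElements.index h)) :=
  ⟨fun _ h _ _ hpq => FiniteTypeElements.index_eq h hpq,
    fun _ _ => FiniteTypeElements.exists_index_mul,
    F.fredholmSubmonoid, fun _ => Iff.rfl, F.indexHom, fun _ _ _ => rfl⟩
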